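/- A G-Motzkin path of length $n$ is a lattice path from $(0,0)$ to $(n,0)$ with steps $\mathbf u=(1,1)$, $\mathbf d=(1,-1)$, $\mathbf h=(1,0)$, $\mathbf v=(0,-1)$ that never goes below the $x$-axis; we write it as the word of its steps and write $\varepsilon$ for the empty path. It is $\mathbf{uvv}$-avoiding if $\mathbf u,\mathbf v,\mathbf v$ never occur as three consecutive steps, and primitive if it begins with $\mathbf u$ and meets the $x$-axis only at its two end points. Let $\sigma$ be the map on $\mathbf{uvv}$-avoiding G-Motzkin paths defined recursively by $\sigma(\varepsilon)=\varepsilon$, $\sigma(\mathbf{uv})=\mathbf{uv}$ and, for every other path $Q$, by the one of the following rules that applies, where $Q'$ and $Q''$ are $\mathbf{uvv}$-avoiding G-Motzkin paths: 1. $\sigma(\mathbf h Q')=\mathbf h\,\sigma(Q')$. 2. $\sigma(\mathbf{uvh}Q')=\mathbf{uvh}\,\sigma(Q')$. 3. $\sigma(\mathbf{uv}Q''Q')=\mathbf u\,\sigma(Q'')\,\mathbf v\,\sigma(Q')$ if $Q''$ is primitive. 4. For $i\ge 0$, $\sigma(\mathbf u^i\mathbf{ud}\mathbf v^iQ')=\mathbf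 u^{j}\mathbf{uv}\mathbf d^{j}\sigma(Q')$ if $i=2j-1$, and $=\mathbf u^{j+1}\mathbf d^{j+1}\sigma(Q')$ if $i=2j$. 5. For $i\ge 0$ and $Q''\ne\varepsilon$, $\sigma(\mathbf u^i\mathbf uQ''\mathbf d\mathbf v^iQ')=\mathbf u^{j}\sigma(Q''\mathbf{uv})\mathbf d^{j}\sigma(Q')$ if $i=2j-1$, and $=\mathbf u^{j+1}\sigma(Q''\mathbf{uv})\mathbf v\mathbf d^{j}\sigma(Q')$ if $i=2j$. 6. For $i\ge 1$ and $Q''\neq\varepsilon$ not primitive, $\sigma(\mathbf u^iQ''\mathbf v^iQ')=\mathbf u^{j}\sigma(Q'')\mathbf v\mathbf d^{j-1}\sigma(Q')$ if $i=2j-1$, and $=\mathbf u^{j}\sigma(Q'')\mathbf d^{j}\sigma(Q')$ if $i=2j$. Let $F_n$ be the number of $\mathbf{uvv}$-avoiding G-Motzkin paths $Q$ of length $n$ with $\sigma(Q)=Q$ (a finite number). Then for every integer $n\ge 0$, $$F_n=\sum_{k=0}^{n}\ \sum_{j=0}^{\lfloor (n-k)/2\rfloor}\ \sum_{i=0}^{j}(-1)^{n-k-i}\binom{2k+j}{j}\binom{j}{i}\binom{n-j-i-2}{n-k-2j-i}\,3^{j-i}\,C_k,$$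 where $C_k=\frac1{k+1}\binom{2k}{k}$ is the $k$-th Catalan number and, for integers $N,m$, $\binom Nm=\frac{N(N-1)\cdots(N-m+1)}{m!}$ if $m\ge0$ and $\binom Nm=0$ if $m<0$. Moreover, as formal power series, with $C(x)=\sum_{k\ge0}C_kx^k$, $$\sum_{n\ge0}F_nx^n=\frac{(1+x)^2}{1+x-3x^2-x^3}\;C\!\left(\frac{x(1+x)}{(1+x-3x^2-x^3)^2}\right).$$ -/

import Mathlib

namespace GMotzkin

/-- The four kinds of steps of a generalized Motzkin path: up, down, horizontal, vertical. -/
inductive Step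
  | u
  | d
  | h
  | v

/-- The horizontal displacement of a step: `u = (1,1)`, `d = (1,-1)`, `h = (1,0)`,
`v = (0,-1)`. -/
def Step.dx : Step → ℕ
  | .u => 1
  | .d => 1
  | .h => 1
  | .v => 0

/-- The vertical displacement of a step. -/
def Step.dy : Step → ℤ
  | .u => 1
  | .d => -1
  | .h => 0
  | .v => -1

/-- A lattice path starting at the origin, as the word of its steps. -/
abbrev Word := List Step

/-- The abscissa of the end point of a path. -/
def length (P : Word) : ℕ := (P.map Step.dx).sum

/-- The ordinate of the end point of a path. -/
def height (P : Word) : ℤ := (P.map Step.dy).sum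

/-- A G-Motzkin path: it never goes below the `x`-axis and ends on it. -/
def IsPath (P : Word) : Prop :=
  (∀ R : Word, R <+: P → 0 ≤ height R) ∧ height P = 0

/-- `P` avoids the pattern `τ`: the steps of `τ` never occur consecutively in `P`. -/
def Avoids (τ P : Word) : Prop := ¬ τ <:+: P

/-- The pattern `uvv`. -/
def uvv : Word := [.u, .v, .v]

/-- `uvv`-avoiding G-Motzkin paths (of any length). -/
def IsUvvPath (P : Word) : Prop := IsPath P ∧ Avoids uvv P

/-- The set of `uvv`-avoiding G-Motzkin paths of length `n`. -/
def uvvPaths (n : ℕ) : Set Word := {P | IsUvvPath P ∧ length P = n}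

/-- A G-Motzkin path is primitive if it begins with an up step and meets the `x`-axis only at its
two end points. -/
def IsPrimitive (P : Word) : Prop :=
  IsPath P ∧ [.u] <+: P ∧ ∀ R : Word, R <+: P → R ≠ [] → R ≠ P → 0 < height R

/-- The word consisting of `i` copies of the step `s`. -/
abbrev pow (s : Step) (i : ℕ) : Word := List.replicate i s

/-- `Q = h Q'`. -/
def Case1 (Q Q' : Word) : Prop :=
  IsUvvPath Q' ∧ Q = [.h] ++ Q'

/-- `Q = u v h Q'`. -/
def Case2 (Q Q' : Word) : Prop :=
  IsUvvPath Q' ∧ Q = [.u, .v, .h] ++ Q'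

/-- `Q = u v Q'' Q'` with `Q''` primitive. -/
def Case3 (Q Q'' Q' : Word) : Prop :=
  IsUvvPath Q'' ∧ IsPrimitive Q'' ∧ IsUvvPath Q' ∧ Q = [.u, .v] ++ Q'' ++ Q'

/-- `Q = u^i u d v^i Q'`. -/
def Case4 (Q : Word) (i : ℕ) (Q' : Word) : Prop :=
  IsUvvPath Q' ∧ Q = pow .u i ++ [.u, .d] ++ pow .v i ++ Q'

/-- `Q = u^i u Q'' d v^i Q'` with `Q''` nonempty. -/
def Case5 (Q : Word) (i : ℕ) (Q'' Q' : Word) : Prop :=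
  IsUvvPath Q'' ∧ Q'' ≠ [] ∧ IsUvvPath Q' ∧
    Q = pow .u i ++ [.u] ++ Q'' ++ [.d] ++ pow .v i ++ Q'

/-- `Q = u^i Q'' v^i Q'` with `i ≥ 1` and `Q''` nonempty and not primitive. -/
def Case6 (Q : Word) (i : ℕ) (Q'' Q' : Word) : Prop :=
  1 ≤ i ∧ IsUvvPath Q'' ∧ Q'' ≠ [] ∧ ¬ IsPrimitive Q'' ∧ IsUvvPath Q' ∧
    Q = pow .u i ++ Q'' ++ pow .v i ++ Q'

theorem length_nil : length [] = 0 := rfl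

theorem length_cons (s : Step) (P : Word) : length (s :: P) = s.dx + length P := by
  simp [length]

theorem length_append (P R : Word) : length (P ++ R) = length P + length R := by
  simp [length]

theorem length_pow (s : Step) (i : ℕ) : length (pow s i) = i * s.dx := by
  simp [length]

open Classical in
/-- The map `σ` on `uvv`-avoiding G-Motzkin paths, by recursion on the length. On every nonempty
path other than `u v` exactly one of the six cases applies, with a unique decomposition. Words
that are not `uvv`-avoiding G-Motzkin paths are irrelevant. -/
noncomputable def sigma (Q : Word) : Word :=
  if Q = [] then []
  else if Q = [.u, .v] then [.u, .v]
  else if h1 : ∃ Q' : Word, Case1 Q Q' then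
    [.h] ++ sigma h1.choose
  else if h2 : ∃ Q' : Word, Case2 Q Q' then
    [.u, .v, .h] ++ sigma h2.choose
  else if h3 : ∃ p : Word × Word, Case3 Q p.1 p.2 then
    [.u] ++ sigma h3.choose.1 ++ [.v] ++ sigma h3.choose.2
  else if h4 : ∃ p : ℕ × Word, Case4 Q p.1 p.2 then
    let i := h4.choose.1
    if Odd i then
      let j := (i + 1) / 2
      pow .u j ++ [.u, .v] ++ pow .d j ++ sigma h4.choose.2
    else
      let j := i / 2
      pow .u (j + 1) ++ pow .d (j + 1) ++ sigma h4.choose.2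
  else if h5 : ∃ p : ℕ × Word × Word, Case5 Q p.1 p.2.1 p.2.2 then
    let i := h5.choose.1
    if Odd i then
      let j := (i + 1) / 2
      pow .u j ++ sigma (h5.choose.2.1 ++ [.u, .v]) ++ pow .d j ++ sigma h5.choose.2.2
    else
      let j := i / 2
      pow .u (j + 1) ++ sigma (h5.choose.2.1 ++ [.u, .v]) ++ [.v] ++ pow .d j
        ++ sigma h5.choose.2.2
  else if h6 : ∃ p : ℕ × Word × Word, Case6 Q p.1 p.2.1 p.2.2 then
    let i := h6.choose.1
    if Odd i then
      let j := (i + 1) / 2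
      pow .u j ++ sigma h6.choose.2.1 ++ [.v] ++ pow .d (j - 1) ++ sigma h6.choose.2.2
    else
      let j := i / 2
      pow .u j ++ sigma h6.choose.2.1 ++ pow .d j ++ sigma h6.choose.2.2
  else []
termination_by length Q
decreasing_by
  · have h := congrArg length h1.choose_spec.2
    simp only [length_append, length_cons, length_nil, Step.dx] at h
    omega
  · have h := congrArg length h2.choose_spec.2
    simp only [length_append, length_cons, length_nil, Step.dx] at h
    omega
  · have h := congrArg length h3.choose_spec.2.2.2
    simp only [length_append, length_cons, length_nil, Step.dx] at h
    omega
  · have h := congrArg length h3.choose_spec.2.2.2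
    simp only [length_append, length_cons, length_nil, Step.dx] at h
    omega
  · have h := congrArg length h4.choose_spec.2
    simp only [length_append, length_cons, length_nil, length_pow, Step.dx] at h
    omega
  · have h := congrArg length h4.choose_spec.2
    simp only [length_append, length_cons, length_nil, length_pow, Step.dx] at h
    omega
  · have h := congrArg length h5.choose_spec.2.2.2
    simp only [length_append, length_cons, length_nil, length_pow, Step.dx] at h ⊢
    omega
  · have h := congrArg length h5.choose_spec.2.2.2
    simp only [length_append, length_cons, length_nil, length_pow, Step.dx] at h
    omega
  · have h := congrArg length h5.choose_spec.2.2.2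
    simp only [length_append, length_cons, length_nil, length_pow, Step.dx] at h ⊢
    omega
  · have h := congrArg length h5.choose_spec.2.2.2
    simp only [length_append, length_cons, length_nil, length_pow, Step.dx] at h
    omega
  · have h := congrArg length h6.choose_spec.2.2.2.2.2
    have h' := h6.choose_spec.1
    simp only [length_append, length_pow, Step.dx] at h
    omega
  · have h := congrArg length h6.choose_spec.2.2.2.2.2
    have h' := h6.choose_spec.1
    simp only [length_append, length_pow, Step.dx] at h
    omega
  · have h := congrArg length h6.choose_spec.2.2.2.2.2
    have h' := h6.choose_spec.1
    simp only [length_append, length_pow, Step.dx] at h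
    omega
  · have h := congrArg length h6.choose_spec.2.2.2.2.2
    have h' := h6.choose_spec.1
    simp only [length_append, length_pow, Step.dx] at h
    omega

/-- The set of fixed points of `σ` on the `uvv`-avoiding G-Motzkin paths of length `n`. -/
def fixedPaths (n : ℕ) : Set Word := {Q | Q ∈ uvvPaths n ∧ sigma Q = Q}

/-- The number of fixed points of `σ` of length `n`. -/
noncomputable def F (n : ℕ) : ℕ := (fixedPaths n).ncard

/-- The binomial coefficient `N (N-1) ⋯ (N-m+1) / m!` for integers `N` and `m ≥ 0`; it is `0` for
`m < 0`. -/
noncomputable def binom (N m : ℤ) : ℤ :=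
  if 0 ≤ m then Ring.choose N m.toNat else 0

open PowerSeries in
/-- The generating function `∑ C_n x^n` of the Catalan numbers. -/
noncomputable def catalanGF : PowerSeries ℚ := PowerSeries.mk fun n => (catalan n : ℚ)

open PowerSeries in
/-- The polynomial `1 + x - 3 x^2 - x^3` as a power series. -/
noncomputable def denom : PowerSeries ℚ := 1 + X - 3 * X ^ 2 - X ^ 3

end GMotzkin

/-!
The map `σ` treats a path block by block, and the point of the proof is that almost no block can be
fixed. A nonempty path that does not begin with `h` factors uniquely as `u P s R` with `P` and `R`
paths and `s` one of `d`, `v` (cut at the first return to the axis, `wrap_inj`). Since `σ` maps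
paths to paths (`isPath_sigma`), the same holds for the image, and in every rule with `i ≥ 2`, in
all instances of `Case5`, and in `Case4` with `i = 1`, one of the path and its image returns by `d`
and the other by `v`. The rule of `Case3` is excluded because `σ` does not increase the length.
What remains (`mem_fixed_iff`) is that a fixed point is a sequence of blocks `h`, `uvh`, `ud` and `u A v`,
possibly followed by a final `uv`; here `A` runs over the nonempty, nonprimitive fixed points that
do not end in `uv` (`core`), the last condition being what avoidance of `uvv` requires.

Let `f`, `t`, `g` be the generating functions of the fixed points, of those not ending in `uv`, and
of `core`. Splitting off the first block gives `f = 1 + x + w f` and `t = 1 + w t` with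
`w = x + 2 x² + x g` (`gf_fixed`, `gf_fixedNotUv`). Separating the empty and the primitive words
gives `t = 1 + g + x² + x g` (`gf_fixedNotUv_eq`). Eliminating `g` yields `f = (1 + x) t` and
`x t² - (1 + x - 3 x² - x³) t + (1 + x) = 0`, whose only power series solution is the Catalan
series in the stated argument, up to a factor (`gf_fixed_eq`).

The sum formula is obtained by expanding the Catalan series, then, with
`1 + x - 3 x² - x³ = (1 + x) (1 - x² (3 + x) / (1 + x))`, the powers of the inverse of the second
factor, and at last `(3 + x) ^ j` and `(1 + x) ^ (1 - k - j)` by the binomial theorem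
(`coeff_gf_fixed`).
-/

namespace GMotzkin

/-! ### Paths, primitive paths and first returns -/

@[simp] theorem height_nil : height [] = 0 := rfl

@[simp] theorem height_cons (s : Step) (P : Word) : height (s :: P) = s.dy + height P := by
  simp [height]

@[simp] theorem height_append (P R : Word) : height (P ++ R) = height P + height R := by
  simp [height]

theorem isPath_nil : IsPath [] := by
  refine ⟨fun R hR => ?_, rfl⟩
  rw [List.prefix_nil] at hR
  simp [hR]

theorem IsPath.append {P R : Word} (hP : IsPath P) (hR : IsPath R) : IsPath (P ++ R) := by
  refine ⟨fun S hS => ?_, by simp [hP.2, hR.2]⟩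
  rcases List.prefix_or_prefix_of_prefix hS (List.prefix_append P R) with h | h
  · exact hP.1 S h
  · obtain ⟨T, rfl⟩ := h
    have := hR.1 T ((List.prefix_append_right_inj P).1 hS)
    simp [hP.2, this]

theorem IsPath.head {s : Step} {P : Word} (h : IsPath (s :: P)) : s = .u ∨ s = .h := by
  have := h.1 [s] (by simp)
  cases s <;> simp [Step.dy] at this ⊢

theorem IsPath.last {s : Step} {P : Word} (h : IsPath (P ++ [s])) : s ≠ .u := by
  rintro rfl
  have h1 := h.1 P (by simp)
  have h2 := h.2
  simp [Step.dy] at h2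
  omega

theorem isPath_h : IsPath [.h] := by
  refine ⟨fun R hR => ?_, rfl⟩
  rcases List.prefix_cons_iff.1 hR with rfl | ⟨t, rfl, ht⟩
  · simp
  · rw [List.prefix_nil] at ht
    simp [ht, Step.dy]

theorem isPrimitive_wrap {P : Word} {s : Step} (hP : IsPath P) (hs : s.dy = -1) :
    IsPrimitive ([.u] ++ P ++ [s]) := by
  have key : ∀ R : Word, R <+: [.u] ++ P ++ [s] → R ≠ [] → R ≠ [.u] ++ P ++ [s] →
      0 < height R := by
    intro R hR h0 h1
    rcases List.prefix_concat_iff.1 hR with h | h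
    · exact absurd h h1
    · rcases List.prefix_cons_iff.1 h with h | ⟨t, rfl, ht⟩
      · exact absurd h h0
      · have := hP.1 t ht
        simp [Step.dy]
        omega
  have h0 : height ([.u] ++ P ++ [s]) = 0 := by
    simp only [height_append, height_cons, height_nil, hP.2, hs]
    simp [Step.dy]
  refine ⟨⟨fun R hR => ?_, h0⟩, by simp, key⟩
  by_cases h1 : R = []
  · simp [h1]
  by_cases h2 : R = [.u] ++ P ++ [s]
  · rw [h2, h0]
  · exact (key R hR h1 h2).le

theorem IsPath.wrap {P : Word} {s : Step} (hP : IsPath P) (hs : s.dy = -1) :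
    IsPath ([.u] ++ P ++ [s]) := (isPrimitive_wrap hP hs).1

theorem pow_wrap_succ (i : ℕ) (P : Word) (s : Step) :
    pow .u (i + 1) ++ P ++ pow s (i + 1) = [.u] ++ (pow .u i ++ P ++ pow s i) ++ [s] := by
  rw [show pow s (i + 1) = pow s i ++ [s] from List.replicate_succ']
  simp [pow, List.replicate_succ]

theorem IsPath.pow_wrap {P : Word} {s : Step} (hP : IsPath P) (hs : s.dy = -1) (i : ℕ) :
    IsPath (pow .u i ++ P ++ pow s i) := by
  induction i with
  | zero => simpa using hP
  | succ i ih => rw [pow_wrap_succ]; exact ih.wrap hs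

theorem IsPrimitive.ne_nil {P : Word} (h : IsPrimitive P) : P ≠ [] := by
  rintro rfl
  simpa using h.2.1

/-- A path is cut at its first return to the axis in only one way. -/
theorem IsPrimitive.append_inj {P P' R R' : Word} (hP : IsPrimitive P) (hP' : IsPrimitive P')
    (h : P ++ R = P' ++ R') : P = P' ∧ R = R' := by
  suffices hh : P = P' by
    subst hh
    exact ⟨rfl, List.append_cancel_left h⟩
  by_contra hne
  rcases List.prefix_or_prefix_of_prefix (List.prefix_append P R)
    (h ▸ List.prefix_append P' R') with h1 | h1
  · have := hP'.2.2 P h1 hP.ne_nil hne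
    rw [hP.1.2] at this
    exact lt_irrefl _ this
  · have := hP.2.2 P' h1 hP'.ne_nil (Ne.symm hne)
    rw [hP'.1.2] at this
    exact lt_irrefl _ this

/-- Two wrapped paths followed by anything agree only if their parts do, since the wrapped path is
the part before the first return to the axis. -/
theorem wrap_inj {P P' R R' : Word} {s s' : Step} (hP : IsPath P) (hP' : IsPath P')
    (hs : s.dy = -1) (hs' : s'.dy = -1)
    (h : [.u] ++ P ++ [s] ++ R = [.u] ++ P' ++ [s'] ++ R') : P = P' ∧ s = s' ∧ R = R' := by
  obtain ⟨h1, h2⟩ := (isPrimitive_wrap hP hs).append_inj (isPrimitive_wrap hP' hs') h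
  obtain ⟨h3, h4⟩ := List.append_inj' h1 rfl
  refine ⟨List.append_cancel_left h3, by simpa using h4, h2⟩

/-! ### Avoidance of `uvv` -/

/-- No occurrence of `uvv` can straddle the boundary, as its part in `B` would begin with `v`. -/
theorem avoids_append {A B : Word} (hA : Avoids uvv A) (hB : Avoids uvv B)
    (hv : ∀ R, B ≠ .v :: R) : Avoids uvv (A ++ B) := by
  intro h
  rcases List.infix_append_iff_ne_nil.1 h with h | h | ⟨t₁, t₂, h1, h2, h3, h4, h5⟩
  · exact hA h
  · exact hB h
  · obtain ⟨R, rfl⟩ := h5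
    rcases t₁ with _ | ⟨a, t₁⟩
    · exact h1 rfl
    rcases t₂ with _ | ⟨b, t₂⟩
    · exact h2 rfl
    apply hv (t₂ ++ R)
    clear hA hB h h4 hv
    rcases t₁ with _ | ⟨c, _ | ⟨e, t₁⟩⟩ <;> simp [uvv] at h3
    · simp [← h3.2.1]
    · simp [← h3.2.2.1]

theorem avoids_append_v {A : Word} (hA : Avoids uvv A) (hv : ¬ [.u, .v] <:+ A) :
    Avoids uvv (A ++ [.v]) := by
  intro h
  rcases List.infix_concat_iff.1 h with h | h
  · have : uvv = [.u, .v] ++ [.v] := rfl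
    rw [this, List.suffix_append_self_iff] at h
    exact hv h
  · exact hA h

theorem avoids_u_cons {A : Word} (hA : Avoids uvv A) (hv : ∀ R, A ≠ .v :: R) :
    Avoids uvv (.u :: A) := by
  refine avoids_append (A := [.u]) (fun h => ?_) hA hv
  have := h.length_le
  simp [uvv] at this

theorem IsPath.ne_v_cons {P : Word} (h : IsPath P) (R : Word) : P ≠ .v :: R := by
  rintro rfl
  simpa using h.head

theorem isUvvPath_nil : IsUvvPath [] := ⟨isPath_nil, fun h => by simp [uvv] at h⟩

theorem IsUvvPath.append {P R : Word} (hP : IsUvvPath P) (hR : IsUvvPath R) :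
    IsUvvPath (P ++ R) :=
  ⟨hP.1.append hR.1, avoids_append hP.2 hR.2 hR.1.ne_v_cons⟩

theorem avoids_of_length_le {P : Word} (h : P.length ≤ 2) : Avoids uvv P := by
  intro h'
  have := h'.length_le
  simp [uvv] at this
  omega

theorem isUvvPath_h : IsUvvPath [.h] := ⟨isPath_h, avoids_of_length_le (by simp)⟩

theorem isUvvPath_uv : IsUvvPath [.u, .v] :=
  ⟨isPath_nil.wrap (s := .v) rfl, avoids_of_length_le (by simp)⟩

theorem isUvvPath_ud : IsUvvPath [.u, .d] :=
  ⟨isPath_nil.wrap (s := .d) rfl, avoids_of_length_le (by simp)⟩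

theorem IsUvvPath.wrap_v {P : Word} (hP : IsUvvPath P) (hv : ¬ [.u, .v] <:+ P) :
    IsUvvPath ([.u] ++ P ++ [.v]) := by
  refine ⟨hP.1.wrap rfl, avoids_append_v (avoids_u_cons hP.2 hP.1.ne_v_cons) fun h => ?_⟩
  rcases List.suffix_cons_iff.1 h with h | h
  · rw [List.cons.injEq] at h
    exact hP.1.ne_v_cons [] h.2.symm
  · exact hv h

/-- A nonempty final path determines whether a word ends in `uv`. -/
theorem suffix_uv_append_iff {A Q : Word} (hQ : IsPath Q) (hQ0 : Q ≠ []) :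
    [.u, .v] <:+ A ++ Q ↔ [.u, .v] <:+ Q := by
  refine ⟨fun h => ?_, fun h => h.trans (List.suffix_append _ _)⟩
  rcases List.suffix_or_suffix_of_suffix h (List.suffix_append A Q) with h | h
  · exact h
  · rcases List.suffix_cons_iff.1 h with h | h
    · simp [h]
    rcases List.suffix_cons_iff.1 h with h | h
    · exact absurd h (hQ.ne_v_cons _)
    · exact absurd (List.suffix_nil.1 h) hQ0

/-! ### The recursion for `σ` -/

/-- The rules of the recursion for `σ`, as a relation between a path and its image: `Case4`, `Case5`
and `Case6` are split by the parity of the exponent `i`. The rule `other` accounts for the default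
value of `sigma` on words to which no rule applies. -/
inductive SigmaRule (Q : Word) : Word → Prop
  | nil : Q = [] → SigmaRule Q []
  | uv : Q = [.u, .v] → SigmaRule Q [.u, .v]
  | h (Q' : Word) : Case1 Q Q' → SigmaRule Q ([.h] ++ sigma Q')
  | uvh (Q' : Word) : Case2 Q Q' → SigmaRule Q ([.u, .v, .h] ++ sigma Q')
  | uvPrimitive (Q'' Q' : Word) : Case3 Q Q'' Q' →
      SigmaRule Q ([.u] ++ sigma Q'' ++ [.v] ++ sigma Q')
  | udOdd (j : ℕ) (Q' : Word) : Case4 Q (2 * j + 1) Q' →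
      SigmaRule Q (pow .u (j + 1) ++ [.u, .v] ++ pow .d (j + 1) ++ sigma Q')
  | udEven (j : ℕ) (Q' : Word) : Case4 Q (2 * j) Q' →
      SigmaRule Q (pow .u (j + 1) ++ pow .d (j + 1) ++ sigma Q')
  | dOdd (j : ℕ) (Q'' Q' : Word) : Case5 Q (2 * j + 1) Q'' Q' →
      SigmaRule Q (pow .u (j + 1) ++ sigma (Q'' ++ [.u, .v]) ++ pow .d (j + 1) ++ sigma Q')
  | dEven (j : ℕ) (Q'' Q' : Word) : Case5 Q (2 * j) Q'' Q' →
      SigmaRule Q (pow .u (j + 1) ++ sigma (Q'' ++ [.u, .v]) ++ [.v] ++ pow .d j ++ sigma Q')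
  | vOdd (j : ℕ) (Q'' Q' : Word) : Case6 Q (2 * j + 1) Q'' Q' →
      SigmaRule Q (pow .u (j + 1) ++ sigma Q'' ++ [.v] ++ pow .d j ++ sigma Q')
  | vEven (j : ℕ) (Q'' Q' : Word) : Case6 Q (2 * j + 2) Q'' Q' →
      SigmaRule Q (pow .u (j + 1) ++ sigma Q'' ++ pow .d (j + 1) ++ sigma Q')
  | other : Q ≠ [] → (¬ ∃ Q', Case1 Q Q') → (¬ ∃ Q', Case2 Q Q') →
      (¬ ∃ p : ℕ × Word, Case4 Q p.1 p.2) →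
      (¬ ∃ p : ℕ × Word × Word, Case6 Q p.1 p.2.1 p.2.2) → SigmaRule Q []

theorem sigmaRule_sigma (Q : Word) : SigmaRule Q (sigma Q) := by
  rw [sigma]
  split_ifs with h0 h0' h1 h2 h3 h4 h5 h6
  · exact .nil h0
  · exact .uv h0'
  · exact .h _ h1.choose_spec
  · exact .uvh _ h2.choose_spec
  · exact .uvPrimitive _ _ h3.choose_spec
  · have hs := h4.choose_spec
    generalize h4.choose = p at hs
    obtain ⟨i, Q'⟩ := p
    dsimp only at hs ⊢
    split_ifs with hi
    · obtain ⟨j, rfl⟩ := hi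
      rw [show (2 * j + 1 + 1) / 2 = j + 1 by omega]
      exact .udOdd j Q' hs
    · obtain ⟨j, rfl⟩ := Nat.not_odd_iff_even.1 hi
      rw [show (j + j) / 2 = j by omega]
      rw [← two_mul] at hs
      exact .udEven j Q' hs
  · have hs := h5.choose_spec
    generalize h5.choose = p at hs
    obtain ⟨i, Q'', Q'⟩ := p
    dsimp only at hs ⊢
    split_ifs with hi
    · obtain ⟨j, rfl⟩ := hi
      rw [show (2 * j + 1 + 1) / 2 = j + 1 by omega]
      exact .dOdd j Q'' Q' hs
    · obtain ⟨j, rfl⟩ := Nat.not_odd_iff_even.1 hi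
      rw [show (j + j) / 2 = j by omega]
      rw [← two_mul] at hs
      exact .dEven j Q'' Q' hs
  · have hs := h6.choose_spec
    generalize h6.choose = p at hs
    obtain ⟨i, Q'', Q'⟩ := p
    dsimp only at hs ⊢
    split_ifs with hi
    · obtain ⟨j, rfl⟩ := hi
      rw [show (2 * j + 1 + 1) / 2 = j + 1 by omega]
      exact .vOdd j Q'' Q' hs
    · obtain ⟨j, rfl⟩ := Nat.not_odd_iff_even.1 hi
      obtain ⟨k, rfl⟩ : ∃ k, j = k + 1 := ⟨j - 1, by have := hs.1; omega⟩
      rw [show (k + 1 + (k + 1)) / 2 = k + 1 by omega]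
      rw [show k + 1 + (k + 1) = 2 * k + 2 by ring] at hs
      exact .vEven k Q'' Q' hs
  · exact .other h0 h1 h2 h4 h6

/-- In fact `σ` preserves the length of `uvv`-avoiding paths. The inequality holds for all words,
whether or not a rule applies. -/
theorem length_sigma_le (Q : Word) : length (sigma Q) ≤ length Q := by
  induction hn : length Q using Nat.strong_induction_on generalizing Q with
  | _ n ih =>
  subst hn
  have ih' : ∀ P : Word, length P < length Q → length (sigma P) ≤ length P :=
    fun P hP => ih _ hP P rfl
  have hQ := sigmaRule_sigma Q
  generalize sigma Q = S at hQ
  cases hQ with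
  | nil h => simp [length_nil]
  | uv h => rw [h]
  | other => simp [length_nil]
  | h Q' h =>
    have hl := congrArg length h.2
    simp only [length_append, length_cons, length_nil, Step.dx] at hl ⊢
    have := ih' Q' (by omega)
    omega
  | uvh Q' h =>
    have hl := congrArg length h.2
    simp only [length_append, length_cons, length_nil, Step.dx] at hl ⊢
    have := ih' Q' (by omega)
    omega
  | uvPrimitive Q'' Q' h =>
    have hl := congrArg length h.2.2.2
    simp only [length_append, length_cons, length_nil, Step.dx] at hl ⊢
    have := ih' Q' (by omega)
    have := ih' Q'' (by omega)
    omega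
  | udOdd j Q' h | udEven j Q' h =>
    have hl := congrArg length h.2
    simp only [length_append, length_cons, length_nil, length_pow, Step.dx] at hl ⊢
    have := ih' Q' (by omega)
    omega
  | dOdd j Q'' Q' h | dEven j Q'' Q' h =>
    have hl := congrArg length h.2.2.2
    simp only [length_append, length_cons, length_nil, length_pow, Step.dx] at hl ⊢
    have := ih' Q' (by omega)
    have := ih' (Q'' ++ [.u, .v])
    simp only [length_append, length_cons, length_nil, Step.dx] at this
    omega
  | vOdd j Q'' Q' h | vEven j Q'' Q' h =>
    have hl := congrArg length h.2.2.2.2.2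
    simp only [length_append, length_cons, length_nil, length_pow, Step.dx] at hl ⊢
    have := ih' Q' (by omega)
    have := ih' Q'' (by omega)
    omega

theorem IsPath.pow_wrap_v_d {P : Word} (hP : IsPath P) (j : ℕ) :
    IsPath (pow .u (j + 1) ++ P ++ [.v] ++ pow .d j) := by
  have := (hP.wrap (s := .v) rfl).pow_wrap (s := .d) rfl j
  rw [show pow Step.u (j + 1) = pow .u j ++ [.u] from List.replicate_succ']
  simpa using this

theorem isPath_sigma {Q : Word} (hQ : IsUvvPath Q) : IsPath (sigma Q) := by
  induction hn : length Q using Nat.strong_induction_on generalizing Q with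
  | _ n ih =>
  subst hn
  have ih' : ∀ P : Word, IsUvvPath P → length P < length Q → IsPath (sigma P) :=
    fun P hP hPQ => ih _ hPQ hP rfl
  have hQS := sigmaRule_sigma Q
  generalize sigma Q = S at hQS
  cases hQS with
  | nil h => exact isPath_nil
  | uv h => exact isUvvPath_uv.1
  | other => exact isPath_nil
  | h Q' h =>
    have hl := congrArg length h.2
    simp only [length_append, length_cons, length_nil, Step.dx] at hl
    exact isPath_h.append (ih' Q' h.1 (by omega))
  | uvh Q' h =>
    have hl := congrArg length h.2
    simp only [length_append, length_cons, length_nil, Step.dx] at hl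
    exact (isUvvPath_uv.1.append isPath_h).append (ih' Q' h.1 (by omega))
  | uvPrimitive Q'' Q' h =>
    have hl := congrArg length h.2.2.2
    simp only [length_append, length_cons, length_nil, Step.dx] at hl
    exact ((ih' Q'' h.1 (by omega)).wrap rfl).append (ih' Q' h.2.2.1 (by omega))
  | udOdd j Q' h =>
    have hl := congrArg length h.2
    simp only [length_append, length_cons, length_nil, length_pow, Step.dx] at hl
    exact (isUvvPath_uv.1.pow_wrap rfl _).append (ih' Q' h.1 (by omega))
  | udEven j Q' h =>
    have hl := congrArg length h.2
    simp only [length_append, length_cons, length_nil, length_pow, Step.dx] at hl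
    have := isPath_nil.pow_wrap (s := .d) rfl (j + 1)
    rw [List.append_nil] at this
    exact this.append (ih' Q' h.1 (by omega))
  | dOdd j Q'' Q' h =>
    have hl := congrArg length h.2.2.2
    simp only [length_append, length_cons, length_nil, length_pow, Step.dx] at hl
    have := ih' (Q'' ++ [.u, .v]) (h.1.append isUvvPath_uv)
    simp only [length_append, length_cons, length_nil, Step.dx] at this
    exact ((this (by omega)).pow_wrap rfl _).append (ih' Q' h.2.2.1 (by omega))
  | dEven j Q'' Q' h =>
    have hl := congrArg length h.2.2.2
    simp only [length_append, length_cons, length_nil, length_pow, Step.dx] at hl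
    have := ih' (Q'' ++ [.u, .v]) (h.1.append isUvvPath_uv)
    simp only [length_append, length_cons, length_nil, Step.dx] at this
    exact ((this (by omega)).pow_wrap_v_d _).append (ih' Q' h.2.2.1 (by omega))
  | vOdd j Q'' Q' h =>
    have hl := congrArg length h.2.2.2.2.2
    simp only [length_append, length_pow, Step.dx] at hl
    exact ((ih' Q'' h.2.1 (by omega)).pow_wrap_v_d _).append (ih' Q' h.2.2.2.2.1 (by omega))
  | vEven j Q'' Q' h =>
    have hl := congrArg length h.2.2.2.2.2
    simp only [length_append, length_pow, Step.dx] at hl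
    exact ((ih' Q'' h.2.1 (by omega)).pow_wrap rfl _).append (ih' Q' h.2.2.2.2.1 (by omega))

/-! ### The fixed points of `σ` -/

theorem IsPath.pow_wrap_cases {P : Word} {s : Step} (hP : IsPath P) (hs : s.dy = -1) (i : ℕ) :
    (i = 0 → pow .u i ++ P ++ pow s i = P) ∧
      (1 ≤ i → IsPrimitive (pow .u i ++ P ++ pow s i)) := by
  refine ⟨fun h => by simp [h], fun h => ?_⟩
  obtain ⟨k, rfl⟩ : ∃ k, i = k + 1 := ⟨i - 1, by omega⟩
  rw [pow_wrap_succ]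
  exact isPrimitive_wrap (hP.pow_wrap hs k) hs

/-- The first return decomposition of a path satisfying `Case4`. -/
theorem Case4.firstReturn {Q Q' : Word} {i : ℕ} (h : Case4 Q i Q') :
    ∃ P s, IsPath P ∧ s.dy = -1 ∧ Q = [.u] ++ P ++ [s] ++ Q' ∧ (i = 0 → P = [] ∧ s = .d) ∧
      (1 ≤ i → IsPrimitive P ∧ s = .v) := by
  rcases i with _ | i
  · exact ⟨[], .d, isPath_nil, rfl, by simpa using h.2, by simp, by simp⟩
  · refine ⟨pow .u i ++ [.u, .d] ++ pow .v i, .v, isUvvPath_ud.1.pow_wrap rfl i, rfl, ?_,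
      by simp, fun _ => ⟨?_, rfl⟩⟩
    · rw [← pow_wrap_succ]
      exact h.2
    · rcases i with _ | i
      · simpa using isPrimitive_wrap isPath_nil (s := .d) rfl
      · exact (isUvvPath_ud.1.pow_wrap_cases rfl _).2 (by omega)

/-- The first return decomposition of a path satisfying `Case5`. -/
theorem Case5.firstReturn {Q Q'' Q' : Word} {i : ℕ} (h : Case5 Q i Q'' Q') :
    ∃ P s, IsPath P ∧ s.dy = -1 ∧ Q = [.u] ++ P ++ [s] ++ Q' ∧ (i = 0 → P = Q'' ∧ s = .d) ∧
      (1 ≤ i → IsPrimitive P ∧ s = .v) := by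
  have hp : IsPrimitive ([.u] ++ Q'' ++ [.d]) := isPrimitive_wrap h.1.1 rfl
  rcases i with _ | i
  · exact ⟨Q'', .d, h.1.1, rfl, by simpa using h.2.2.2, by simp, by simp⟩
  · refine ⟨pow .u i ++ ([.u] ++ Q'' ++ [.d]) ++ pow .v i, .v, hp.1.pow_wrap rfl i, rfl, ?_,
      by simp, fun _ => ⟨?_, rfl⟩⟩
    · rw [← pow_wrap_succ, h.2.2.2]
      simp
    · rcases i with _ | i
      · simpa using hp
      · exact (hp.1.pow_wrap_cases rfl _).2 (by omega)

/-- The first return decomposition of a path satisfying `Case6`. -/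
theorem Case6.firstReturn {Q Q'' Q' : Word} {i : ℕ} (h : Case6 Q i Q'' Q') :
    ∃ P, IsPath P ∧ Q = [.u] ++ P ++ [.v] ++ Q' ∧ (i = 1 → P = Q'') ∧
      (i ≠ 1 → IsPrimitive P) := by
  obtain ⟨k, rfl⟩ : ∃ k, i = k + 1 := ⟨i - 1, by have := h.1; omega⟩
  refine ⟨pow .u k ++ Q'' ++ pow .v k, h.2.1.1.pow_wrap rfl k, ?_, fun hk => ?_, fun hk => ?_⟩
  · rw [← pow_wrap_succ]
    exact h.2.2.2.2.2
  · exact (h.2.1.1.pow_wrap_cases rfl k).1 (by omega)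
  · exact (h.2.1.1.pow_wrap_cases rfl k).2 (by omega)

theorem Case2.firstReturn {Q Q' : Word} (h : Case2 Q Q') :
    Q = [.u] ++ [] ++ [.v] ++ ([.h] ++ Q') := h.2

theorem Case3.firstReturn {Q Q'' Q' : Word} (h : Case3 Q Q'' Q') :
    Q = [.u] ++ [] ++ [.v] ++ (Q'' ++ Q') := by simp [h.2.2.2]

theorem sigma_nil : sigma [] = [] := by rw [sigma]; simp

theorem sigma_uv : sigma [.u, .v] = [.u, .v] := by rw [sigma]; simp

theorem sigma_h {Q' : Word} (hQ' : IsUvvPath Q') : sigma ([.h] ++ Q') = [.h] ++ sigma Q' := by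
  have hQS := sigmaRule_sigma ([.h] ++ Q')
  generalize sigma ([.h] ++ Q') = S at hQS
  cases hQS with
  | nil h => simp at h
  | uv h => simp at h
  | other _ h => exact absurd ⟨Q', hQ', rfl⟩ h
  | h Q1 h => rw [List.append_cancel_left h.2]
  | uvh Q1 h => simpa using h.firstReturn
  | uvPrimitive Q2 Q1 h => simpa using h.firstReturn
  | udOdd j Q1 h | udEven j Q1 h | dOdd j Q2 Q1 h | dEven j Q2 Q1 h =>
    obtain ⟨P, s, -, -, h, -⟩ := h.firstReturn
    simp at h
  | vOdd j Q2 Q1 h | vEven j Q2 Q1 h =>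
    obtain ⟨P, -, h, -⟩ := h.firstReturn
    simp at h

theorem sigma_uvh {Q' : Word} (hQ' : IsUvvPath Q') :
    sigma ([.u, .v, .h] ++ Q') = [.u, .v, .h] ++ sigma Q' := by
  have hQS := sigmaRule_sigma ([.u, .v, .h] ++ Q')
  generalize sigma ([.u, .v, .h] ++ Q') = S at hQS
  have hQ : [.u, .v, .h] ++ Q' = [.u] ++ [] ++ [.v] ++ ([.h] ++ Q') := rfl
  cases hQS with
  | nil h => simp at h
  | uv h => simp at h
  | other _ _ h => exact absurd ⟨Q', hQ', rfl⟩ h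
  | h Q1 h => simp [Case1] at h
  | uvh Q1 h => rw [List.append_cancel_left h.2]
  | uvPrimitive Q2 Q1 h =>
    obtain ⟨R, rfl⟩ := h.2.1.2.1
    simpa using h.firstReturn
  | udOdd j Q1 h =>
    obtain ⟨P, s, hP, hs, h, -, h1⟩ := h.firstReturn
    obtain ⟨rfl, -⟩ := wrap_inj isPath_nil hP rfl hs (hQ.symm.trans h)
    exact absurd rfl (h1 (by omega)).1.ne_nil
  | udEven j Q1 h =>
    obtain ⟨P, s, hP, hs, h, h0, h1⟩ := h.firstReturn
    obtain ⟨rfl, rfl, -⟩ := wrap_inj isPath_nil hP rfl hs (hQ.symm.trans h)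
    rcases Nat.eq_zero_or_pos (2 * j) with hj | hj
    · simpa using (h0 hj).2
    · exact absurd rfl (h1 hj).1.ne_nil
  | dOdd j Q2 Q1 h =>
    obtain ⟨P, s, hP, hs, h, -, h1⟩ := h.firstReturn
    obtain ⟨rfl, -⟩ := wrap_inj isPath_nil hP rfl hs (hQ.symm.trans h)
    exact absurd rfl (h1 (by omega)).1.ne_nil
  | dEven j Q2 Q1 h =>
    obtain ⟨P, s, hP, hs, h, h0, h1⟩ := h.firstReturn
    obtain ⟨rfl, rfl, -⟩ := wrap_inj isPath_nil hP rfl hs (hQ.symm.trans h)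
    rcases Nat.eq_zero_or_pos (2 * j) with hj | hj
    · simpa using (h0 hj).2
    · exact absurd rfl (h1 hj).1.ne_nil
  | vOdd j Q2 Q1 h | vEven j Q2 Q1 h =>
    obtain ⟨P, hP, hP', h0, h1⟩ := h.firstReturn
    obtain ⟨rfl, -⟩ := wrap_inj isPath_nil hP rfl rfl (hQ.symm.trans hP')
    exact absurd (h0 (by_contra fun hj => (h1 hj).ne_nil rfl)).symm h.2.2.1

theorem sigma_ud {Q' : Word} (hQ' : IsUvvPath Q') :
    sigma ([.u, .d] ++ Q') = [.u, .d] ++ sigma Q' := by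
  have hQS := sigmaRule_sigma ([.u, .d] ++ Q')
  generalize sigma ([.u, .d] ++ Q') = S at hQS
  have hQ : [.u, .d] ++ Q' = [.u] ++ [] ++ [.d] ++ Q' := rfl
  cases hQS with
  | nil h => simp at h
  | uv h => simp at h
  | other _ _ _ h => exact absurd ⟨(0, Q'), hQ', by simp⟩ h
  | h Q1 h => simp [Case1] at h
  | uvh Q1 h => simpa using h.firstReturn
  | uvPrimitive Q2 Q1 h => simpa using h.firstReturn
  | udOdd j Q1 h =>
    obtain ⟨P, s, hP, hs, h, -, h1⟩ := h.firstReturn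
    obtain ⟨rfl, -⟩ := wrap_inj isPath_nil hP rfl hs (hQ.symm.trans h)
    exact absurd rfl (h1 (by omega)).1.ne_nil
  | udEven j Q1 h =>
    obtain ⟨P, s, hP, hs, h, h0, h1⟩ := h.firstReturn
    obtain ⟨rfl, rfl, rfl⟩ := wrap_inj isPath_nil hP rfl hs (hQ.symm.trans h)
    rcases Nat.eq_zero_or_pos (2 * j) with hj | hj
    · obtain rfl : j = 0 := by omega
      simp
    · exact absurd rfl (h1 hj).1.ne_nil
  | dOdd j Q2 Q1 h =>
    obtain ⟨P, s, hP, hs, h, -, h1⟩ := h.firstReturn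
    obtain ⟨rfl, -⟩ := wrap_inj isPath_nil hP rfl hs (hQ.symm.trans h)
    exact absurd rfl (h1 (by omega)).1.ne_nil
  | dEven j Q2 Q1 h =>
    obtain ⟨P, s, hP, hs, h', h0, h1⟩ := h.firstReturn
    obtain ⟨rfl, rfl, -⟩ := wrap_inj isPath_nil hP rfl hs (hQ.symm.trans h')
    rcases Nat.eq_zero_or_pos (2 * j) with hj | hj
    · exact absurd (h0 hj).1.symm h.2.1
    · exact absurd rfl (h1 hj).1.ne_nil
  | vOdd j Q2 Q1 h | vEven j Q2 Q1 h =>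
    obtain ⟨P, hP, hP', h0, h1⟩ := h.firstReturn
    obtain ⟨-, h, -⟩ := wrap_inj isPath_nil hP rfl rfl (hQ.symm.trans hP')
    simp at h

theorem sigma_wrap_v {A Q' : Word} (hA : IsUvvPath A) (hA0 : A ≠ []) (hA1 : ¬ IsPrimitive A)
    (hQ' : IsUvvPath Q') :
    sigma ([.u] ++ A ++ [.v] ++ Q') = [.u] ++ sigma A ++ [.v] ++ sigma Q' := by
  have hQS := sigmaRule_sigma ([.u] ++ A ++ [.v] ++ Q')
  generalize sigma ([.u] ++ A ++ [.v] ++ Q') = S at hQS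
  cases hQS with
  | nil h => simp at h
  | uv h =>
    have h' : [.u] ++ A ++ [.v] ++ Q' = [.u] ++ [] ++ [.v] ++ [] := h
    exact absurd (wrap_inj hA.1 isPath_nil rfl rfl h').1 hA0
  | other _ _ _ _ h => exact absurd ⟨(1, A, Q'), le_rfl, hA, hA0, hA1, hQ', by simp⟩ h
  | h Q1 h => simp [Case1] at h
  | uvh Q1 h => exact absurd (wrap_inj hA.1 isPath_nil rfl rfl h.firstReturn).1 hA0
  | uvPrimitive Q2 Q1 h => exact absurd (wrap_inj hA.1 isPath_nil rfl rfl h.firstReturn).1 hA0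
  | udOdd j Q1 h =>
    obtain ⟨P, s, hP, hs, h, -, h1⟩ := h.firstReturn
    obtain ⟨rfl, -⟩ := wrap_inj hA.1 hP rfl hs h
    exact absurd (h1 (by omega)).1 hA1
  | udEven j Q1 h =>
    obtain ⟨P, s, hP, hs, h, h0, h1⟩ := h.firstReturn
    obtain ⟨rfl, rfl, rfl⟩ := wrap_inj hA.1 hP rfl hs h
    rcases Nat.eq_zero_or_pos (2 * j) with hj | hj
    · exact absurd (h0 hj).1 hA0
    · exact absurd (h1 hj).1 hA1
  | dOdd j Q2 Q1 h =>
    obtain ⟨P, s, hP, hs, h, -, h1⟩ := h.firstReturn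
    obtain ⟨rfl, -⟩ := wrap_inj hA.1 hP rfl hs h
    exact absurd (h1 (by omega)).1 hA1
  | dEven j Q2 Q1 h =>
    obtain ⟨P, s, hP, hs, h', h0, h1⟩ := h.firstReturn
    obtain ⟨rfl, rfl, -⟩ := wrap_inj hA.1 hP rfl hs h'
    rcases Nat.eq_zero_or_pos (2 * j) with hj | hj
    · simpa using (h0 hj).2
    · exact absurd (h1 hj).1 hA1
  | vOdd j Q2 Q1 h =>
    obtain ⟨P, hP, hP', h0, h1⟩ := h.firstReturn
    obtain ⟨rfl, -, rfl⟩ := wrap_inj hA.1 hP rfl rfl hP'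
    rcases Nat.eq_zero_or_pos j with rfl | hj
    · rw [h0 rfl]
      simp
    · exact absurd (h1 (by omega)) hA1
  | vEven j Q2 Q1 h =>
    obtain ⟨P, hP, hP', h0, h1⟩ := h.firstReturn
    obtain ⟨rfl, -, rfl⟩ := wrap_inj hA.1 hP rfl rfl hP'
    exact absurd (h1 (by omega)) hA1

/-- The fixed points of `σ`, of all lengths. -/
def fixed : Set Word := {Q | IsUvvPath Q ∧ sigma Q = Q}

/-- The fixed points `A` of `σ` for which `u A v` begins a fixed point: `Case6` with
`i = 1` requires that `A` be nonempty and not primitive, and avoidance of `uvv` that `A` not end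
in `uv`. -/
def core : Set Word := {A | A ∈ fixed ∧ A ≠ [] ∧ ¬ IsPrimitive A ∧ ¬ [.u, .v] <:+ A}

/-- A word whose first return to the axis is by `v` differs from one whose first return is
by `d`. -/
theorem wrap_v_ne_wrap_d {P P' R R' : Word} (hP : IsPath P) (hP' : IsPath P') :
    [.u] ++ P ++ [.v] ++ R ≠ [.u] ++ P' ++ [.d] ++ R' := by
  intro h
  have := (wrap_inj hP hP' rfl rfl h).2.1
  simp at this

/-- The block decomposition of the fixed points of `σ`. -/
theorem mem_fixed_iff {Q : Word} :
    Q ∈ fixed ↔ Q = [] ∨ Q = [.u, .v] ∨ (∃ Q' ∈ fixed, Q = [.h] ++ Q') ∨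
      (∃ Q' ∈ fixed, Q = [.u, .v, .h] ++ Q') ∨ (∃ Q' ∈ fixed, Q = [.u, .d] ++ Q') ∨
      ∃ A ∈ core, ∃ Q' ∈ fixed, Q = [.u] ++ A ++ [.v] ++ Q' := by
  constructor
  · rintro ⟨hQ, hσ⟩
    have hQS := sigmaRule_sigma Q
    generalize hS : sigma Q = S at hQS
    rw [hσ] at hS
    cases hQS with
    | nil h => exact .inl h
    | uv h => exact .inr (.inl h)
    | other h => exact absurd hS h
    | h Q' h =>
      exact .inr (.inr (.inl ⟨Q', ⟨h.1, List.append_cancel_left (hS.symm.trans h.2)⟩, h.2⟩))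
    | uvh Q' h =>
      exact .inr (.inr (.inr (.inl ⟨Q', ⟨h.1, List.append_cancel_left (hS.symm.trans h.2)⟩, h.2⟩)))
    | uvPrimitive Q'' Q' h =>
      -- `σ(Q'')` would be empty, so that `Q'' Q' = σ(Q')`, which is too long
      have h1 := h.firstReturn.symm.trans hS
      obtain ⟨-, -, h2⟩ := wrap_inj isPath_nil (isPath_sigma h.1) rfl rfl h1
      have h3 := congrArg length h2
      have h4 := length_sigma_le Q'
      obtain ⟨R, hR⟩ := h.2.1.2.1
      have h5 := congrArg length hR
      simp only [length_append, length_cons, length_nil, Step.dx] at h3 h5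
      omega
    | udOdd j Q' h =>
      obtain ⟨P, s, hP, hs, h, -, h1⟩ := h.firstReturn
      obtain ⟨-, rfl⟩ := h1 (by omega)
      rw [pow_wrap_succ, h] at hS
      exact absurd hS (wrap_v_ne_wrap_d hP (isUvvPath_uv.1.pow_wrap rfl j))
    | udEven j Q' hc =>
      obtain ⟨P, s, hP, hs, h, h0, h1⟩ := hc.firstReturn
      have := pow_wrap_succ j [] .d
      rw [List.append_nil] at this
      rw [this, h] at hS
      obtain ⟨-, rfl, hQ'⟩ := wrap_inj hP (isPath_nil.pow_wrap rfl j) hs rfl hS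
      rcases Nat.eq_zero_or_pos (2 * j) with hj | hj
      · refine .inr (.inr (.inr (.inr (.inl ⟨Q', ⟨hc.1, hQ'.symm⟩, ?_⟩))))
        rw [h, (h0 hj).1]
        rfl
      · simpa using (h1 hj).2
    | dOdd j Q'' Q' hc =>
      obtain ⟨P, s, hP, hs, h, -, h1⟩ := hc.firstReturn
      obtain ⟨-, rfl⟩ := h1 (by omega)
      rw [pow_wrap_succ, h] at hS
      exact absurd hS (wrap_v_ne_wrap_d hP
        ((isPath_sigma (hc.1.append isUvvPath_uv)).pow_wrap rfl j))
    | dEven j Q'' Q' hc =>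
      obtain ⟨P, s, hP, hs, h, h0, h1⟩ := hc.firstReturn
      have hσ' := isPath_sigma (hc.1.append isUvvPath_uv)
      rcases j with _ | j
      · obtain ⟨-, rfl⟩ := h0 rfl
        have hS' : [.u] ++ P ++ [.d] ++ Q' =
            [.u] ++ sigma (Q'' ++ [.u, .v]) ++ [.v] ++ sigma Q' := by
          rw [← h, hS]
          simp
        exact absurd hS'.symm (wrap_v_ne_wrap_d hσ' hP)
      · obtain ⟨-, rfl⟩ := h1 (by omega)
        have hS' : [.u] ++ P ++ [.v] ++ Q' = [.u] ++ (pow .u (j + 1) ++ sigma (Q'' ++ [.u, .v]) ++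
            [.v] ++ pow .d j) ++ [.d] ++ sigma Q' := by
          rw [← h, hS, show pow Step.d (j + 1) = pow .d j ++ [.d] from List.replicate_succ',
            show pow Step.u (j + 1 + 1) = [.u] ++ pow .u (j + 1) from List.replicate_succ]
          simp only [List.append_assoc]
        exact absurd hS' (wrap_v_ne_wrap_d hP (hσ'.pow_wrap_v_d j))
    | vOdd j Q'' Q' hc =>
      obtain ⟨P, hP, h, h0, -⟩ := hc.firstReturn
      have hσ' := isPath_sigma hc.2.1
      rcases j with _ | j
      · obtain rfl := h0 rfl
        have hS' : [.u] ++ P ++ [.v] ++ Q' = [.u] ++ sigma P ++ [.v] ++ sigma Q' := by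
          rw [← h, hS]
          simp
        obtain ⟨h1, -, h2⟩ := wrap_inj hP hσ' rfl rfl hS'
        refine .inr (.inr (.inr (.inr (.inr ⟨P, ⟨⟨hc.2.1, h1.symm⟩, hc.2.2.1, hc.2.2.2.1, ?_⟩,
          Q', ⟨hc.2.2.2.2.1, h2.symm⟩, h⟩))))
        rintro ⟨R, rfl⟩
        exact hQ.2 ⟨[.u] ++ R, Q', by rw [h]; simp [uvv]⟩
      · have hS' : [.u] ++ P ++ [.v] ++ Q' = [.u] ++ (pow .u (j + 1) ++ sigma Q'' ++
            [.v] ++ pow .d j) ++ [.d] ++ sigma Q' := by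
          rw [← h, hS, show pow Step.d (j + 1) = pow .d j ++ [.d] from List.replicate_succ',
            show pow Step.u (j + 1 + 1) = [.u] ++ pow .u (j + 1) from List.replicate_succ]
          simp only [List.append_assoc]
        exact absurd hS' (wrap_v_ne_wrap_d hP (hσ'.pow_wrap_v_d j))
    | vEven j Q'' Q' hc =>
      obtain ⟨P, hP, h, -⟩ := hc.firstReturn
      rw [pow_wrap_succ, h] at hS
      exact absurd hS (wrap_v_ne_wrap_d hP ((isPath_sigma hc.2.1).pow_wrap rfl j))
  · rintro (rfl | rfl | ⟨Q', h, rfl⟩ | ⟨Q', h, rfl⟩ | ⟨Q', h, rfl⟩ | ⟨A, hA, Q', h, rfl⟩)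
    · exact ⟨isUvvPath_nil, sigma_nil⟩
    · exact ⟨isUvvPath_uv, sigma_uv⟩
    · exact ⟨isUvvPath_h.append h.1, by rw [sigma_h h.1, h.2]⟩
    · exact ⟨(isUvvPath_uv.append isUvvPath_h).append h.1, by rw [sigma_uvh h.1, h.2]⟩
    · exact ⟨isUvvPath_ud.append h.1, by rw [sigma_ud h.1, h.2]⟩
    · exact ⟨(hA.1.1.wrap_v hA.2.2.2).append h.1,
        by rw [sigma_wrap_v hA.1.1 hA.2.1 hA.2.2.1 h.1, h.2, hA.1.2]⟩

/-! ### Generating functions of sets of words -/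

open PowerSeries in
/-- The generating function of the set `S` with respect to the size function `w`. It is meaningful
when `S` has finitely many elements of each size. -/
noncomputable def gf {α : Type*} (w : α → ℕ) (S : Set α) : PowerSeries ℚ :=
  PowerSeries.mk fun n => ({a | a ∈ S ∧ w a = n}.ncard : ℚ)

theorem gf_union {α : Type*} {w : α → ℕ} {S T : Set α} (hS : ∀ n, {a | a ∈ S ∧ w a = n}.Finite)
    (hT : ∀ n, {a | a ∈ T ∧ w a = n}.Finite) (h : Disjoint S T) :
    gf w (S ∪ T) = gf w S + gf w T := by
  ext n
  simp only [gf, map_add, PowerSeries.coeff_mk]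
  rw [← Nat.cast_add, ← Set.ncard_union_eq ?_ (hS n) (hT n)]
  · congr 2
    ext a
    simp [or_and_right]
  · exact h.mono (fun _ ha => ha.1) (fun _ ha => ha.1)

theorem gf_singleton {α : Type*} (w : α → ℕ) (a : α) : gf w {a} = PowerSeries.X ^ w a := by
  ext n
  rw [gf, PowerSeries.coeff_mk, PowerSeries.coeff_X_pow]
  split_ifs with h
  · rw [show {b | b ∈ ({a} : Set α) ∧ w b = n} = {a} by ext b; simp; grind]
    simp
  · rw [show {b | b ∈ ({a} : Set α) ∧ w b = n} = ∅ by ext b; simp; grind]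
    simp

theorem gf_image {α β : Type*} {w : α → ℕ} {w' : β → ℕ} {S : Set α} {f : α → β} (c : ℕ)
    (hf : Set.InjOn f S) (hw : ∀ a ∈ S, w' (f a) = c + w a) :
    gf w' (f '' S) = PowerSeries.X ^ c * gf w S := by
  ext n
  rw [PowerSeries.coeff_X_pow_mul', gf, gf, PowerSeries.coeff_mk, PowerSeries.coeff_mk]
  have h : {b | b ∈ f '' S ∧ w' b = n} = f '' {a | a ∈ S ∧ c + w a = n} := by
    ext b
    constructor
    · rintro ⟨⟨a, ha, rfl⟩, hn⟩
      exact ⟨a, ⟨ha, hw a ha ▸ hn⟩, rfl⟩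
    · rintro ⟨a, ⟨ha, hn⟩, rfl⟩
      exact ⟨⟨a, ha, rfl⟩, (hw a ha).trans hn⟩
  rw [h, (hf.mono fun _ ha => ha.1).ncard_image]
  split_ifs with hc
  · congr 2
    ext a
    simp only [Set.mem_ofPred_eq, and_congr_right_iff]
    omega
  · rw [show {a | a ∈ S ∧ c + w a = n} = ∅ by ext a; simp; omega]
    simp

theorem gf_prod {α β : Type*} {w : α → ℕ} {w' : β → ℕ} {S : Set α} {T : Set β}
    (hS : ∀ n, {a | a ∈ S ∧ w a = n}.Finite) (hT : ∀ n, {a | a ∈ T ∧ w' a = n}.Finite) :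
    gf (fun p : α × β => w p.1 + w' p.2) (S ×ˢ T) = gf w S * gf w' T := by
  ext n
  rw [PowerSeries.coeff_mul]
  simp only [gf, PowerSeries.coeff_mk]
  let U : Finset (Σ _ : ℕ × ℕ, α × β) :=
    (Finset.HasAntidiagonal.antidiagonal n).sigma fun ij => (hS ij.1).toFinset ×ˢ (hT ij.2).toFinset
  have hU : {p | p ∈ S ×ˢ T ∧ w p.1 + w' p.2 = n} =
      Sigma.snd '' (U : Set (Σ _ : ℕ × ℕ, α × β)) := by
    ext p
    constructor
    · rintro ⟨⟨h1, h2⟩, h3⟩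
      exact ⟨⟨(w p.1, w' p.2), p⟩, by simp [U, h1, h2, h3], rfl⟩
    · rintro ⟨⟨ij, q⟩, hq, rfl⟩
      simp only [U, Finset.coe_sigma, Set.mem_sigma_iff, Finset.mem_coe,
        Finset.HasAntidiagonal.mem_antidiagonal,
        Finset.mem_product, Set.Finite.mem_toFinset, Set.mem_ofPred_eq] at hq
      obtain ⟨h, ⟨h1, h2⟩, h3, h4⟩ := hq
      exact ⟨⟨h1, h3⟩, by rw [h2, h4, h]⟩
  have hinj : Set.InjOn Sigma.snd (U : Set (Σ _ : ℕ × ℕ, α × β)) := by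
    rintro ⟨⟨i, j⟩, q⟩ hq ⟨⟨i', j'⟩, q'⟩ hq' h
    simp only [U, Finset.coe_sigma, Set.mem_sigma_iff, Finset.mem_coe,
        Finset.HasAntidiagonal.mem_antidiagonal,
      Finset.mem_product, Set.Finite.mem_toFinset, Set.mem_ofPred_eq] at hq hq' h
    subst h
    obtain ⟨-, ⟨-, h2⟩, -, h4⟩ := hq
    obtain ⟨-, ⟨-, h2'⟩, -, h4'⟩ := hq'
    rw [← h2, ← h4, ← h2', ← h4']
  rw [hU, hinj.ncard_image, Set.ncard_coe_finset, Finset.card_sigma]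
  push_cast
  refine Finset.sum_congr rfl fun ij _ => ?_
  rw [Finset.card_product, Set.ncard_eq_toFinset_card _ (hS _), Set.ncard_eq_toFinset_card _ (hT _)]
  push_cast
  rfl

instance finite_step : Finite Step :=
  Finite.of_surjective (fun i : Fin 4 => ![Step.u, .d, .h, .v] i) fun s => by
    cases s
    · exact ⟨0, rfl⟩
    · exact ⟨1, rfl⟩
    · exact ⟨2, rfl⟩
    · exact ⟨3, rfl⟩

/-- A vertical step has length zero, but there cannot be more of them than up steps. -/
theorem list_length_add_height_le (Q : Word) : (Q.length : ℤ) + height Q ≤ 2 * (length Q : ℤ) := by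
  induction Q with
  | nil => simp [length_nil]
  | cons s Q ih =>
    rw [length_cons, height_cons, List.length_cons]
    cases s <;> simp [Step.dx, Step.dy] <;> omega

theorem finite_isPath {S : Set Word} (hS : ∀ Q ∈ S, IsPath Q) (n : ℕ) :
    {Q | Q ∈ S ∧ length Q = n}.Finite := by
  refine (List.finite_length_le Step (2 * n)).subset fun Q hQ => ?_
  have h1 := list_length_add_height_le Q
  rw [(hS Q hQ.1).2, hQ.2] at h1
  simp only [Set.mem_ofPred_eq]
  omega

/-! ### Functional equations -/

/-- The fixed points of `σ` not ending in `uv`. -/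
def fixedNotUv : Set Word := {Q | Q ∈ fixed ∧ ¬ [.u, .v] <:+ Q}

theorem isPath_of_mem_fixed {Q : Word} (h : Q ∈ fixed) : IsPath Q := h.1.1

theorem isPath_of_mem_core {Q : Word} (h : Q ∈ core) : IsPath Q := h.1.1.1

theorem wrap_v_append_injOn {S : Set Word} :
    Set.InjOn (fun x : Word × Word => [.u] ++ x.1 ++ [.v] ++ x.2) (core ×ˢ S) := by
  rintro ⟨A, Q⟩ h ⟨A', Q'⟩ h' hAQ
  obtain ⟨h1, -, h2⟩ :=
    wrap_inj (isPath_of_mem_core h.1) (isPath_of_mem_core h'.1) rfl rfl hAQ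
  exact Prod.ext h1 h2

open PowerSeries in
/-- The functional equation for the fixed points of `σ` subject to a condition `p` which
does not depend on the first block of the decomposition in `mem_fixed_iff`. -/
theorem gf_fixed_and (p : Word → Prop)
    (hh : ∀ Q ∈ fixed, p ([.h] ++ Q) ↔ p Q) (huvh : ∀ Q ∈ fixed, p ([.u, .v, .h] ++ Q) ↔ p Q)
    (hud : ∀ Q ∈ fixed, p ([.u, .d] ++ Q) ↔ p Q)
    (hcore : ∀ A ∈ core, ∀ Q ∈ fixed, p ([.u] ++ A ++ [.v] ++ Q) ↔ p Q) :
    gf length {Q | Q ∈ fixed ∧ p Q} = gf length {Q | (Q = [] ∨ Q = [.u, .v]) ∧ p Q} +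
      (X + 2 * X ^ 2 + X * gf length core) * gf length {Q | Q ∈ fixed ∧ p Q} := by
  set S := {Q | Q ∈ fixed ∧ p Q}
  set E := {Q : Word | (Q = [] ∨ Q = [.u, .v]) ∧ p Q}
  let fW : Word × Word → Word := fun x => [.u] ++ x.1 ++ [.v] ++ x.2
  have hSE : S = (((E ∪ (fun Q => [.h] ++ Q) '' S) ∪ (fun Q => [.u, .v, .h] ++ Q) '' S) ∪
      (fun Q => [.u, .d] ++ Q) '' S) ∪ fW '' (core ×ˢ S) := by
    ext Q
    constructor
    · rintro ⟨hQ, hp⟩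
      rcases mem_fixed_iff.1 hQ with h | h | ⟨Q', h, rfl⟩ | ⟨Q', h, rfl⟩ | ⟨Q', h, rfl⟩ |
        ⟨A, hA, Q', h, rfl⟩
      · exact .inl (.inl (.inl (.inl ⟨.inl h, hp⟩)))
      · exact .inl (.inl (.inl (.inl ⟨.inr h, hp⟩)))
      · exact .inl (.inl (.inl (.inr ⟨Q', ⟨h, (hh Q' h).1 hp⟩, rfl⟩)))
      · exact .inl (.inl (.inr ⟨Q', ⟨h, (huvh Q' h).1 hp⟩, rfl⟩))
      · exact .inl (.inr ⟨Q', ⟨h, (hud Q' h).1 hp⟩, rfl⟩)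
      · exact .inr ⟨(A, Q'), ⟨hA, ⟨h, (hcore A hA Q' h).1 hp⟩⟩, rfl⟩
    · rintro ((((⟨h | h, hp⟩ | ⟨Q', h, rfl⟩) | ⟨Q', h, rfl⟩) | ⟨Q', h, rfl⟩) |
        ⟨⟨A, Q'⟩, ⟨hA, h⟩, rfl⟩)
      · exact ⟨mem_fixed_iff.2 (.inl h), hp⟩
      · exact ⟨mem_fixed_iff.2 (.inr (.inl h)), hp⟩
      · exact ⟨mem_fixed_iff.2 (.inr (.inr (.inl ⟨Q', h.1, rfl⟩))), (hh Q' h.1).2 h.2⟩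
      · exact ⟨mem_fixed_iff.2 (.inr (.inr (.inr (.inl ⟨Q', h.1, rfl⟩)))), (huvh Q' h.1).2 h.2⟩
      · exact ⟨mem_fixed_iff.2 (.inr (.inr (.inr (.inr (.inl ⟨Q', h.1, rfl⟩))))),
          (hud Q' h.1).2 h.2⟩
      · exact ⟨mem_fixed_iff.2 (.inr (.inr (.inr (.inr (.inr ⟨A, hA, Q', h.1, rfl⟩))))),
          (hcore A hA Q' h.1).2 h.2⟩
  have hpath : ∀ Q ∈ S, IsPath Q := fun Q hQ => hQ.1.1.1
  have hfin : ∀ T ⊆ S, ∀ n, {Q | Q ∈ T ∧ length Q = n}.Finite :=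
    fun T hT => finite_isPath fun Q hQ => hpath Q (hT hQ)
  -- words of the last kind differ from the others by their first return to the axis
  have d4 : Disjoint (((E ∪ (fun Q => [.h] ++ Q) '' S) ∪ (fun Q => [.u, .v, .h] ++ Q) '' S) ∪
      (fun Q => [.u, .d] ++ Q) '' S) (fW '' (core ×ˢ S)) := by
    rw [Set.disjoint_right]
    rintro _ ⟨⟨A, Q'⟩, ⟨hA, -⟩, rfl⟩ h
    have hA' := isPath_of_mem_core hA
    rcases h with (((⟨h | h, -⟩ | ⟨R, -, h⟩) | ⟨R, -, h⟩) | ⟨R, -, h⟩)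
    · simp [fW] at h
    · have h' : [.u] ++ A ++ [.v] ++ Q' = [.u] ++ [] ++ [.v] ++ [] := h
      exact hA.2.1 (wrap_inj hA' isPath_nil rfl rfl h').1
    · simp [fW] at h
    · have h' : [.u] ++ [] ++ [.v] ++ ([.h] ++ R) = [.u] ++ A ++ [.v] ++ Q' := h
      exact hA.2.1 (wrap_inj isPath_nil hA' rfl rfl h').1.symm
    · have h' : [.u] ++ [] ++ [.d] ++ R = [.u] ++ A ++ [.v] ++ Q' := h
      exact wrap_v_ne_wrap_d hA' isPath_nil h'.symm
  have d3 : Disjoint ((E ∪ (fun Q => [.h] ++ Q) '' S) ∪ (fun Q => [.u, .v, .h] ++ Q) '' S)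
      ((fun Q => [.u, .d] ++ Q) '' S) := by
    rw [Set.disjoint_right]
    rintro _ ⟨Q', -, rfl⟩ ((⟨h | h, -⟩ | ⟨R, -, h⟩) | ⟨R, -, h⟩) <;> simp at h
  have d2 : Disjoint (E ∪ (fun Q => [.h] ++ Q) '' S) ((fun Q => [.u, .v, .h] ++ Q) '' S) := by
    rw [Set.disjoint_right]
    rintro _ ⟨Q', -, rfl⟩ (⟨h | h, -⟩ | ⟨R, -, h⟩) <;> simp at h
  have d1 : Disjoint E ((fun Q => [.h] ++ Q) '' S) := by
    rw [Set.disjoint_right]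
    rintro _ ⟨Q', -, rfl⟩ ⟨h | h, -⟩ <;> simp at h
  have s5 : fW '' (core ×ˢ S) ⊆ S := Set.subset_union_right.trans hSE.symm.subset
  have s4 := Set.subset_union_left.trans hSE.symm.subset
  have s3 := Set.subset_union_left.trans s4
  have s2 := Set.subset_union_left.trans s3
  have s1 := Set.subset_union_left.trans s2
  have hinj : ∀ B : Word, Set.InjOn (fun Q => B ++ Q) S :=
    fun B Q _ Q' _ h => List.append_cancel_left h
  have hE' : gf length S = _ := congrArg (gf length) hSE
  rw [gf_union (hfin _ s4) (hfin _ s5) d4,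
    gf_union (hfin _ s3) (hfin _ (Set.subset_union_right.trans s4)) d3,
    gf_union (hfin _ s2) (hfin _ (Set.subset_union_right.trans s3)) d2,
    gf_union (hfin _ s1) (hfin _ (Set.subset_union_right.trans s2)) d1,
    gf_image (w := length) 1 (hinj _) (by intros; simp [length_cons, Step.dx]),
    gf_image (w := length) 2 (hinj _) (by intros; simp [length_cons, Step.dx]; omega),
    gf_image (w := length) 2 (hinj _) (by intros; simp [length_cons, Step.dx]; omega),
    gf_image (w := fun x : Word × Word => length x.1 + length x.2) 1 wrap_v_append_injOn
      (by
        intros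
        simp only [length_append, length_cons, length_nil, Step.dx]
        omega),
    gf_prod (finite_isPath fun _ => isPath_of_mem_core) (hfin _ le_rfl)] at hE'
  linear_combination hE'

theorem not_uv_suffix_block {B Q : Word} (hB : ¬ [.u, .v] <:+ B) (hQ : Q ∈ fixed) :
    ¬ [.u, .v] <:+ B ++ Q ↔ ¬ [.u, .v] <:+ Q := by
  by_cases h : Q = []
  · subst h
    simpa using hB
  · rw [suffix_uv_append_iff hQ.1.1 h]

theorem not_uv_suffix_wrap_v {A : Word} (hA : A ∈ core) : ¬ [.u, .v] <:+ [.u] ++ A ++ [.v] := by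
  intro h
  obtain ⟨R, hR⟩ := h
  have h1 : R ++ [.u] = [.u] ++ A :=
    List.append_cancel_right (bs := [.v]) (by simpa using hR)
  rcases List.eq_nil_or_concat A with h | ⟨A', s, h⟩
  · exact hA.2.1 h
  · rw [List.concat_eq_append] at h
    subst h
    obtain ⟨-, h⟩ := List.append_inj' (h1.trans (List.append_assoc _ _ _).symm) rfl
    exact (isPath_of_mem_core hA).last (List.cons.inj h).1.symm

open PowerSeries in
theorem gf_fixed :
    gf length fixed = 1 + X + (X + 2 * X ^ 2 + X * gf length core) * gf length fixed := by
  have h := gf_fixed_and (fun _ => True) (by simp) (by simp) (by simp) (by simp)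
  simp only [and_true, Set.ofPred_mem_eq] at h
  have h0 : {Q : Word | Q = [] ∨ Q = [.u, .v]} = {[]} ∪ {[.u, .v]} := rfl
  rw [h0, gf_union (finite_isPath (by simp [isPath_nil]))
    (finite_isPath (by simp [isUvvPath_uv.1])) (by simp), gf_singleton, gf_singleton] at h
  simpa [length_cons, length_nil, Step.dx] using h

open PowerSeries in
theorem gf_fixedNotUv :
    gf length fixedNotUv =
      1 + (X + 2 * X ^ 2 + X * gf length core) * gf length fixedNotUv := by
  have h := gf_fixed_and (fun Q => ¬ [.u, .v] <:+ Q)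
    (fun Q hQ => not_uv_suffix_block (by simp [List.suffix_cons_iff]) hQ)
    (fun Q hQ => not_uv_suffix_block (by simp [List.suffix_cons_iff]) hQ)
    (fun Q hQ => not_uv_suffix_block (by simp [List.suffix_cons_iff]) hQ)
    (fun A hA Q hQ => not_uv_suffix_block (not_uv_suffix_wrap_v hA) hQ)
  have h0 : {Q : Word | (Q = [] ∨ Q = [.u, .v]) ∧ ¬ [.u, .v] <:+ Q} = {[]} := by
    ext Q
    simp only [Set.mem_ofPred_eq, Set.mem_singleton_iff]
    constructor
    · rintro ⟨rfl | rfl, h⟩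
      · rfl
      · exact absurd (List.suffix_refl _) h
    · rintro rfl
      simp
  rw [h0, gf_singleton, length_nil, pow_zero] at h
  exact h

/-- A fixed point not ending in `uv` is empty, in `core`, or primitive; in the last case it
consists of one block of the decomposition in `mem_fixed_iff`. -/
theorem fixedNotUv_eq :
    fixedNotUv = (({[]} ∪ core) ∪ {[.u, .d]}) ∪ (fun A => [.u] ++ A ++ [.v]) '' core := by
  ext Q
  constructor
  · rintro ⟨hQ, hv⟩
    by_cases h0 : Q = []
    · exact .inl (.inl (.inl h0))
    by_cases h1 : IsPrimitive Q
    · rcases mem_fixed_iff.1 hQ with h | h | ⟨Q', h, h'⟩ | ⟨Q', h, h'⟩ | ⟨Q', h, h'⟩ |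
        ⟨A, hA, Q', h, h'⟩
      · exact absurd h h0
      · exact absurd (h ▸ List.suffix_refl _) hv
      · have := h1.2.1
        rw [h'] at this
        simp at this
      · have h2 := h1.append_inj (R := []) (isPrimitive_wrap isPath_nil (s := .v) rfl)
          (R' := [.h] ++ Q') (by simpa using h')
        simp at h2
      · have h2 := h1.append_inj (R := []) (isPrimitive_wrap isPath_nil (s := .d) rfl)
          (R' := Q') (by simpa using h')
        exact .inl (.inr h2.1)
      · have h2 := h1.append_inj (R := [])
          (isPrimitive_wrap (isPath_of_mem_core hA) (s := .v) rfl) (R' := Q') (by simpa using h')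
        exact .inr ⟨A, hA, h2.1.symm⟩
    · exact .inl (.inl (.inr ⟨hQ, h0, h1, hv⟩))
  · have hnil := mem_fixed_iff.2 (.inl rfl)
    rintro (((h | h) | h) | ⟨A, hA, rfl⟩)
    · rw [Set.mem_singleton_iff] at h
      subst h
      exact ⟨hnil, by simp⟩
    · exact ⟨h.1, h.2.2.2⟩
    · rw [Set.mem_singleton_iff] at h
      subst h
      exact ⟨mem_fixed_iff.2 (.inr (.inr (.inr (.inr (.inl ⟨[], hnil, by simp⟩))))),
        by simp [List.suffix_cons_iff]⟩
    · exact ⟨mem_fixed_iff.2 (.inr (.inr (.inr (.inr (.inr ⟨A, hA, [], hnil, by simp⟩))))),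
        not_uv_suffix_wrap_v hA⟩

open PowerSeries in
theorem gf_fixedNotUv_eq :
    gf length fixedNotUv = 1 + gf length core + X ^ 2 + X * gf length core := by
  have hpath : ∀ Q ∈ fixedNotUv, IsPath Q := fun Q hQ => hQ.1.1.1
  have hfin : ∀ T ⊆ fixedNotUv, ∀ n, {Q | Q ∈ T ∧ length Q = n}.Finite :=
    fun T hT => finite_isPath fun Q hQ => hpath Q (hT hQ)
  have d3 : Disjoint (({[]} ∪ core) ∪ {[.u, .d]}) ((fun A => [.u] ++ A ++ [.v]) '' core) := by
    rw [Set.disjoint_right]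
    rintro _ ⟨A, hA, rfl⟩ ((h | h) | h)
    · simp at h
    · exact h.2.2.1 (isPrimitive_wrap (isPath_of_mem_core hA) rfl)
    · have h' : [.u] ++ A ++ [.v] ++ [] = [.u] ++ [] ++ [.d] ++ [] := by simpa using h
      exact wrap_v_ne_wrap_d (isPath_of_mem_core hA) isPath_nil h'
  have d2 : Disjoint ({[]} ∪ core) ({[.u, .d]} : Set Word) := by
    rw [Set.disjoint_singleton_right]
    rintro (h | h)
    · simp at h
    · exact h.2.2.1 (isPrimitive_wrap isPath_nil (s := .d) rfl)
  have d1 : Disjoint ({[]} : Set Word) core := by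
    rw [Set.disjoint_singleton_left]
    exact fun h => h.2.1 rfl
  have s4 := Set.subset_union_right.trans fixedNotUv_eq.symm.subset
  have s3 := Set.subset_union_left.trans fixedNotUv_eq.symm.subset
  have s2 := Set.subset_union_left.trans s3
  have s1 := Set.subset_union_left.trans s2
  rw [fixedNotUv_eq, gf_union (hfin _ s3) (hfin _ s4) d3,
    gf_union (hfin _ s2) (hfin _ (Set.subset_union_right.trans s3)) d2,
    gf_union (hfin _ s1) (hfin _ (Set.subset_union_right.trans s2)) d1,
    gf_image (w := length) 1 (fun A _ A' _ h => by simpa using h)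
      (by
        intros
        simp only [length_append, length_cons, length_nil, Step.dx]
        omega), gf_singleton, gf_singleton]
  simp [length_cons, length_nil, Step.dx]

open PowerSeries in
/-- The generating function of `core` is eliminated, which leaves a quadratic
equation for the fixed points not ending in `uv`. -/
theorem fixedNotUv_quadratic :
    gf length fixed = (1 + X) * gf length fixedNotUv ∧
      X * gf length fixedNotUv ^ 2 - denom * gf length fixedNotUv + (1 + X) = 0 := by
  have h1 := gf_fixed
  have h2 := gf_fixedNotUv
  have h3 := gf_fixedNotUv_eq
  set f := gf length fixed
  set t := gf length fixedNotUv
  set g := gf length core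
  have h4 : (1 - (X + 2 * X ^ 2 + X * g)) * t = 1 := by linear_combination h2
  constructor
  · linear_combination t * h1 - f * h4
  · rw [denom]
    linear_combination (-(1 + X : PowerSeries ℚ)) * h4 + X * t * h3

/-! ### Solution of the quadratic equation -/

theorem constantCoeff_denom : PowerSeries.constantCoeff denom = 1 := by
  simp [denom]

theorem denom_mul_inv : denom * denom⁻¹ = 1 :=
  PowerSeries.mul_inv_cancel _ (by rw [constantCoeff_denom]; exact one_ne_zero)

theorem denom_sq_inv : (denom ^ 2)⁻¹ = denom⁻¹ ^ 2 := by
  rw [sq, PowerSeries.mul_inv_rev, sq]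

open PowerSeries in
theorem catalanGF_eq : catalanGF = 1 + X * catalanGF ^ 2 := by
  have h : catalanGF = PowerSeries.map (Nat.castRingHom ℚ) catalanSeries := by
    ext n
    simp [catalanGF]
  have h' := congrArg (PowerSeries.map (Nat.castRingHom ℚ)) catalanSeries_sq_mul_X_add_one
  simp only [map_add, map_mul, map_pow, map_one, PowerSeries.map_X, ← h] at h'
  linear_combination -h'

open PowerSeries in
theorem hasSubst_of_X_dvd {y : PowerSeries ℚ} (h : X ∣ y) : HasSubst y :=
  HasSubst.of_constantCoeff_zero' (X_dvd_iff.1 h)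

open PowerSeries in
theorem subst_catalanGF {y : PowerSeries ℚ} (h : X ∣ y) :
    (subst y catalanGF : PowerSeries ℚ) = 1 + y * (subst y catalanGF : PowerSeries ℚ) ^ 2 := by
  have hy := hasSubst_of_X_dvd h
  conv_lhs => rw [catalanGF_eq]
  rw [← coe_substAlgHom hy, map_add, map_mul, map_pow, map_one, substAlgHom_X]

open PowerSeries in
/-- The closed form of the generating function: the quadratic equation has the Catalan series as
a solution, and only one solution is a power series. -/
theorem gf_fixed_eq :
    gf length fixed = (1 + X) ^ 2 * denom⁻¹ *
      (subst (X * (1 + X) * (denom ^ 2)⁻¹) catalanGF : PowerSeries ℚ) := by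
  obtain ⟨h1, h2⟩ := fixedNotUv_quadratic
  have hC := subst_catalanGF (y := X * (1 + X) * (denom ^ 2)⁻¹)
    (by rw [mul_assoc]; exact dvd_mul_right _ _)
  set C : PowerSeries ℚ := subst (X * (1 + X) * (denom ^ 2)⁻¹) catalanGF
  set t := gf length fixedNotUv
  rw [denom_sq_inv] at hC
  have hD := denom_mul_inv
  set s : PowerSeries ℚ := (1 + X) * denom⁻¹ * C with hs
  have h3 : X * s ^ 2 - denom * s + (1 + X) = 0 := by
    rw [hs]
    linear_combination (-(1 + X : PowerSeries ℚ)) * hC - (1 + X) * C * hD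
  -- the two roots of the quadratic coincide, since `X (t + s) - denom` has constant term `-1`
  have h4 : (t - s) * (X * (t + s) - denom) = 0 := by linear_combination h2 - h3
  have h5 : X * (t + s) - denom ≠ 0 := by
    intro h
    have := congrArg constantCoeff h
    simp [constantCoeff_denom] at this
  have h6 : t = s := sub_eq_zero.1 ((mul_eq_zero.1 h4).resolve_right h5)
  rw [h1, h6, hs]
  ring

/-! ### Extraction of coefficients -/

open PowerSeries in
/-- Only finitely many powers of `y` contribute to a given coefficient of a series in `y`. -/
theorem coeff_mul_subst {y : PowerSeries ℚ} {a N m : ℕ} (hy : X ^ a ∣ y) (ha : 0 < a)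
    (hm : m < a * N) (A f : PowerSeries ℚ) :
    coeff m (A * (subst y f : PowerSeries ℚ)) =
      ∑ j ∈ Finset.range N, coeff j f * coeff m (A * y ^ j) := by
  have hy' := hasSubst_of_X_dvd ((dvd_pow_self X ha.ne').trans hy)
  set p : PowerSeries ℚ := ∑ j ∈ Finset.range N, coeff j f • X ^ j with hp
  obtain ⟨g, hg⟩ : X ^ N ∣ f - p := by
    rw [X_pow_dvd_iff]
    intro i hi
    simp [hp, coeff_X_pow, hi]
  have hs : (subst y f : PowerSeries ℚ) =
      ∑ j ∈ Finset.range N, coeff j f • y ^ j + y ^ N * (subst y g : PowerSeries ℚ) := by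
    conv_lhs => rw [← add_sub_cancel p f, hg]
    rw [← coe_substAlgHom hy', map_add, map_mul, map_pow, substAlgHom_X, hp, map_sum]
    simp only [map_smul, map_pow, substAlgHom_X]
  have h0 : coeff m (A * (y ^ N * (subst y g : PowerSeries ℚ))) = 0 := by
    have h : X ^ (a * N) ∣ A * (y ^ N * (subst y g : PowerSeries ℚ)) := by
      rw [pow_mul]
      exact (pow_dvd_pow_of_dvd hy N).trans ((dvd_mul_right _ _).trans (dvd_mul_left _ _))
    exact X_pow_dvd_iff.1 h m hm
  rw [hs, mul_add, map_add, h0, add_zero, Finset.mul_sum, map_sum]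
  refine Finset.sum_congr rfl fun j _ => ?_
  rw [mul_smul_comm, coeff_smul, smul_eq_mul]

open PowerSeries in
theorem subst_mul_one_sub_pow {y : PowerSeries ℚ} (h : X ∣ y) (d : ℕ) :
    (subst y (PowerSeries.mk fun n => (Nat.choose (d + n) d : ℚ)) : PowerSeries ℚ) *
      (1 - y) ^ (d + 1) = 1 := by
  have hy := hasSubst_of_X_dvd h
  have := congrArg (substAlgHom hy) (mk_add_choose_mul_one_sub_pow_eq_one ℚ d)
  rwa [map_mul, map_pow, map_sub, map_one, substAlgHom_X, coe_substAlgHom] at this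

/-- Negation of the upper index of a binomial coefficient. -/
theorem choose_one_sub (m : ℕ) (r s : ℤ) (h : r = 1 - s) :
    Ring.choose r m = (-1) ^ m * Ring.choose (s + m - 2) m := by
  obtain rfl : r = -(s - 1) := by rw [h]; ring
  rw [Ring.choose_neg, show s - 1 + m - 1 = s + m - 2 by ring, Units.smul_def,
    Int.coe_negOnePow_natCast]
  simp

open PowerSeries in
theorem one_add_X_mul_binomialSeries :
    (1 + X) * binomialSeries ℚ (-1 : ℤ) = 1 := by
  have h := binomialSeries_nat (R := ℤ) (A := ℚ) 1
  rw [pow_one] at h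
  rw [← h, ← binomialSeries_add]
  simp

open PowerSeries in
/-- Powers of `1 + x` with an integer exponent. -/
theorem one_add_X_pow_mul (a b : ℕ) :
    (1 + X) ^ a * binomialSeries ℚ (-1 : ℤ) ^ b = binomialSeries ℚ ((a : ℤ) - b) := by
  have h1 : (1 + X) ^ a = binomialSeries ℚ ((a : ℤ) - b) * (1 + X) ^ b := by
    rw [← binomialSeries_nat (R := ℤ) (A := ℚ) a, ← binomialSeries_nat (R := ℤ) (A := ℚ) b,
      ← binomialSeries_add, sub_add_cancel]
  rw [h1, mul_assoc, ← mul_pow, one_add_X_mul_binomialSeries, one_pow, mul_one]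

open PowerSeries in
/-- The expansion of the powers of `denom⁻¹`, from
`denom = (1 + x) (1 - x ^ 2 (3 + x) / (1 + x))`. -/
theorem denom_inv_pow (d : ℕ) :
    denom⁻¹ ^ (d + 1) = binomialSeries ℚ (-1 : ℤ) ^ (d + 1) *
      (subst (X ^ 2 * ((X + 3) * binomialSeries ℚ (-1 : ℤ)))
        (PowerSeries.mk fun n => (Nat.choose (d + n) d : ℚ)) : PowerSeries ℚ) := by
  have hV := one_add_X_mul_binomialSeries
  set V := binomialSeries ℚ (-1 : ℤ)
  have hS := subst_mul_one_sub_pow (y := X ^ 2 * ((X + 3) * V))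
    ((dvd_pow_self X two_ne_zero).trans (dvd_mul_right _ _)) d
  set S : PowerSeries ℚ := subst (X ^ 2 * ((X + 3) * V))
    (PowerSeries.mk fun n => (Nat.choose (d + n) d : ℚ))
  have hD : denom = (1 + X) * (1 - X ^ 2 * ((X + 3) * V)) := by
    rw [denom]
    linear_combination (X ^ 2 * (X + 3)) * hV
  have h1 : denom ^ (d + 1) * (V ^ (d + 1) * S) = 1 := by
    rw [hD, mul_pow]
    calc _ = ((1 + X) * V) ^ (d + 1) * (S * (1 - X ^ 2 * ((X + 3) * V)) ^ (d + 1)) := by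
          rw [mul_pow]
          ring
      _ = 1 := by rw [hV, hS, one_pow, one_mul]
  have h2 : denom⁻¹ ^ (d + 1) * denom ^ (d + 1) = 1 := by
    rw [← mul_pow, mul_comm, denom_mul_inv, one_pow]
  calc _ = denom⁻¹ ^ (d + 1) * (denom ^ (d + 1) * (V ^ (d + 1) * S)) := by rw [h1, mul_one]
    _ = V ^ (d + 1) * S := by rw [← mul_assoc, h2, one_mul]

theorem binom_natCast (a b : ℕ) : binom a b = (a.choose b : ℤ) := by
  rw [binom, if_pos (Int.natCast_nonneg _), Int.toNat_natCast, Ring.choose_natCast]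

open PowerSeries in
theorem coeff_X_add_three_pow_mul_binomialSeries {n k j : ℕ} (hk : k ≤ n)
    (hj : 2 * j ≤ n - k) :
    coeff (n - k) (X ^ (2 * j) * ((X + 3) ^ j * binomialSeries ℚ ((1 : ℤ) - k - j))) =
      ((∑ i ∈ Finset.range (j + 1), (-1 : ℤ) ^ (n - k - i) * binom (j : ℤ) i *
        binom ((n : ℤ) - j - i - 2) ((n : ℤ) - k - 2 * j - i) * 3 ^ (j - i) : ℤ) : ℚ) := by
  rw [coeff_X_pow_mul', if_pos hj, add_pow, Finset.sum_mul, map_sum, Int.cast_sum]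
  refine Finset.sum_congr rfl fun i _ => ?_
  have h3 : (X : PowerSeries ℚ) ^ i * 3 ^ (j - i) * (j.choose i : PowerSeries ℚ) *
      binomialSeries ℚ ((1 : ℤ) - k - j) =
      X ^ i * (C (3 ^ (j - i) * (j.choose i : ℚ)) * binomialSeries ℚ ((1 : ℤ) - k - j)) := by
    simp only [map_mul, map_pow, map_natCast, map_ofNat]
    ring
  rw [h3, coeff_X_pow_mul', binom_natCast]
  split_ifs with hi
  · obtain ⟨m, rfl⟩ : ∃ m, n = k + 2 * j + i + m := ⟨n - k - 2 * j - i, by omega⟩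
    rw [coeff_C_mul, binomialSeries_coeff, binom,
      show ((k + 2 * j + i + m : ℕ) : ℤ) - k - 2 * j - i = m by push_cast; ring,
      if_pos (Int.natCast_nonneg _), Int.toNat_natCast,
      show k + 2 * j + i + m - k - 2 * j - i = m by omega,
      show k + 2 * j + i + m - k - i = m + 2 * j by omega,
      choose_one_sub m _ ((k : ℤ) + j) (by ring),
      show ((k + 2 * j + i + m : ℕ) : ℤ) - j - i - 2 = (k : ℤ) + j + m - 2 by push_cast; ring,
      pow_add, pow_mul, neg_one_sq, one_pow]
    simp only [zsmul_eq_mul]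
    push_cast
    ring
  · rw [binom, if_neg (by omega)]
    simp

open PowerSeries in
theorem coeff_gf_fixed (n : ℕ) :
    coeff n (gf length fixed) =
      ((∑ k ∈ Finset.range (n + 1), ∑ j ∈ Finset.range ((n - k) / 2 + 1),
          ∑ i ∈ Finset.range (j + 1),
            (-1 : ℤ) ^ (n - k - i) * binom (2 * (k : ℤ) + j) j * binom (j : ℤ) i
              * binom ((n : ℤ) - j - i - 2) ((n : ℤ) - k - 2 * j - i)
              * 3 ^ (j - i) * (catalan k : ℤ) : ℤ) : ℚ) := by
  rw [gf_fixed_eq, coeff_mul_subst (a := 1) (N := n + 1)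
    (by rw [pow_one, mul_assoc]; exact dvd_mul_right _ _) one_pos (by omega), Int.cast_sum]
  refine Finset.sum_congr rfl fun k hk => ?_
  have hk' : k ≤ n := by simpa [Nat.lt_succ_iff] using hk
  set V := binomialSeries ℚ (-1 : ℤ) with hV
  -- the term of index `k` of the Catalan series
  have h1 : (1 + X) ^ 2 * denom⁻¹ * (X * (1 + X) * (denom ^ 2)⁻¹) ^ k =
      X ^ k * ((1 + X) ^ (k + 2) * denom⁻¹ ^ (2 * k + 1)) := by
    rw [denom_sq_inv]
    simp only [mul_pow, ← pow_mul]
    ring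
  rw [h1, denom_inv_pow, coeff_X_pow_mul', if_pos hk', ← mul_assoc ((1 + X) ^ (k + 2)),
    coeff_mul_subst (a := 2) (N := (n - k) / 2 + 1) (dvd_mul_right _ _) two_pos (by omega),
    Finset.mul_sum, Int.cast_sum]
  refine Finset.sum_congr rfl fun j hj => ?_
  have hj' : 2 * j ≤ n - k := by
    have := Finset.mem_range.1 hj
    omega
  -- the term of index `j` in the expansion of `denom⁻¹ ^ (2 * k + 1)`
  have h2 : (1 + X) ^ (k + 2) * V ^ (2 * k + 1) * (X ^ 2 * ((X + 3) * V)) ^ j =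
      X ^ (2 * j) * ((X + 3) ^ j * binomialSeries ℚ ((1 : ℤ) - k - j)) := by
    have h3 := one_add_X_pow_mul (k + 2) (2 * k + 1 + j)
    rw [show ((k + 2 : ℕ) : ℤ) - (2 * k + 1 + j : ℕ) = 1 - k - j by push_cast; ring] at h3
    rw [← h3, hV]
    simp only [mul_pow, ← pow_mul]
    ring
  rw [h2, coeff_X_add_three_pow_mul_binomialSeries hk' hj', catalanGF, coeff_mk, coeff_mk,
    show 2 * (k : ℤ) + j = (2 * k + j : ℕ) by push_cast; ring, binom_natCast,
    Nat.choose_symm_add, ← Int.cast_natCast (catalan k), ← Int.cast_natCast (Nat.choose _ _),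
    ← Int.cast_mul, ← Int.cast_mul, Finset.mul_sum, Finset.mul_sum]
  congr 1
  refine Finset.sum_congr rfl fun i _ => ?_
  ring

theorem fixedPaths_eq (n : ℕ) : fixedPaths n = {Q | Q ∈ fixed ∧ length Q = n} := by
  ext Q
  simp only [fixedPaths, uvvPaths, fixed, Set.mem_ofPred_eq]
  tauto

end GMotzkin

theorem mainTheorem2 :
    (∀ n : ℕ, (GMotzkin.fixedPaths n).Finite ∧
      (GMotzkin.F n : ℤ) =
        ∑ k ∈ Finset.range (n + 1), ∑ j ∈ Finset.range ((n - k) / 2 + 1),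
          ∑ i ∈ Finset.range (j + 1),
            (-1 : ℤ) ^ (n - k - i)
              * GMotzkin.binom (2 * (k : ℤ) + j) j
              * GMotzkin.binom (j : ℤ) i
              * GMotzkin.binom ((n : ℤ) - j - i - 2) ((n : ℤ) - k - 2 * j - i)
              * 3 ^ (j - i) * (catalan k : ℤ)) ∧
    PowerSeries.mk (fun n : ℕ => (GMotzkin.F n : ℚ)) =
      (1 + PowerSeries.X) ^ 2 * GMotzkin.denom⁻¹
        * PowerSeries.subst (PowerSeries.X * (1 + PowerSeries.X) * (GMotzkin.denom ^ 2)⁻¹)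
            GMotzkin.catalanGF := by
  have hF : PowerSeries.mk (fun n : ℕ => (GMotzkin.F n : ℚ)) =
      GMotzkin.gf GMotzkin.length GMotzkin.fixed := by
    simp only [GMotzkin.F, GMotzkin.fixedPaths_eq, GMotzkin.gf]
  refine ⟨fun n => ⟨?_, ?_⟩, hF.trans GMotzkin.gf_fixed_eq⟩
  · rw [GMotzkin.fixedPaths_eq]
    exact GMotzkin.finite_isPath (fun _ => GMotzkin.isPath_of_mem_fixed) n
  · have h := GMotzkin.coeff_gf_fixed n
    rw [← hF, PowerSeries.coeff_mk, ← Int.cast_natCast] at h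
    exact Int.cast_injective h
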